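/- Let $(R,\mathfrak m,k)$ be a noetherian local ring (respectively, a standard graded algebra over a field $k$ with graded maximal ideal $\mathfrak m$). For a finitely generated (respectively, finitely generated graded) $R$-module $M$ with minimal (graded) free resolution $F$, let $\operatorname{lin}^R F$ be the associated graded complex of $F$ with respect to the filtration $(\mathcal G^nF)_i=\mathfrak m^{n-i}F_i$ (where $\mathfrak m^j=R$ for $j\le 0$), and let $$\operatorname{ld}_R M=\sup\{i : H_i(\operatorname{lin}^R F)\neq 0\}\in\{0,1,2,\dots\}\cup\{\infty\}$$ be the linearity defect of $M$ (with $\operatorname{ld}_R 0=0$). Let $\operatorname{pd}_R M$ denote the projective dimension of $M$. Let $0\to M\to P\to N\to 0$ be an exact sequence of nonzero finitely generated $R$-modules (respectively, of nonzero finitely generated graded $R$-modules and homogeneous maps of degree $0$). Then 1. $\operatorname{ld}_R N\le\min\{\max\{\operatorname{pd}_R P+1,\operatorname{ld}_R M+1\},\ \max\{\operatorname{ld}_R P,\operatorname{pd}_R M+1\}\}$; 2. $\operatorname{ld}_R P\le\min\{\max\{\operatorname{pd}_R M+1,\operatorname{ld}_R N\},\ \max\{\operatorname{ld}_R M,\operatorname{pd}_R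 N\}\}$; 3. $\operatorname{ld}_R M\le\min\{\max\{\operatorname{ld}_R N-1,\operatorname{pd}_R P\},\ \max\{\operatorname{pd}_R N,\operatorname{ld}_R P\}\}$. In particular: (a) If $P$ is free, then $\operatorname{ld}_R M=\operatorname{ld}_R N-1$ if $\operatorname{ld}_R N\ge 1$ (where $\infty-1=\infty$), and $\operatorname{ld}_R M=0$ otherwise. (b) If one of the modules $M$, $P$, $N$ has finite projective dimension, then the other two have both finite or both infinite linearity defect. -/

import Mathlib

universe u v w

noncomputable section

/-! ### Minimal free resolutions and their linear parts

Everything is relative to an ideal `m` of a commutative ring `R`; it is used for the maximal ideal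
of a noetherian local ring and for the graded maximal ideal of a standard graded algebra. -/

/-- A minimal free resolution
`⋯ → R ^ rank 2 → R ^ rank 1 → R ^ rank 0 → M → 0` of `M` by free modules of finite rank, with
`∂ (F (i + 1)) ⊆ m (F i)` for all `i`. -/
structure MinimalFreeResolution {R : Type u} [CommRing R] (m : Ideal R)
    (M : Type v) [AddCommGroup M] [Module R M] where
  /-- the ranks (Betti numbers) -/
  rank : ℕ → ℕ
  /-- the differential `F (i + 1) → F i` -/
  d : ∀ i : ℕ, (Fin (rank (i + 1)) → R) →ₗ[R] (Fin (rank i) → R)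
  /-- the augmentation `F 0 → M` -/
  ε : (Fin (rank 0) → R) →ₗ[R] M
  ε_surjective : Function.Surjective ε
  exact_zero : Function.Exact (d 0) ε
  exact_succ : ∀ i : ℕ, Function.Exact (d (i + 1)) (d i)
  minimal : ∀ i : ℕ, LinearMap.range (d i) ≤ m • (⊤ : Submodule R (Fin (rank i) → R))

namespace MinimalFreeResolution

variable {R : Type u} [CommRing R] {m : Ideal R} {M : Type v} [AddCommGroup M] [Module R M]

/-- The filtration `(𝒢ⁿ F)_i = m ^ (n - i) F_i`. The truncated subtraction of natural numbers is
intended, as `m ^ j = R` for `j ≤ 0`. -/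
def filtration (F : MinimalFreeResolution m M) (n i : ℕ) : Submodule R (Fin (F.rank i) → R) :=
  m ^ (n - i) • ⊤

/-- The differential maps `(𝒢ⁿ F)_(i + 1)` into `(𝒢ⁿ F)_i`. -/
theorem filtration_le_comap (F : MinimalFreeResolution m M) (n i : ℕ) :
    F.filtration n (i + 1) ≤ (F.filtration n i).comap (F.d i) := by
  rw [← Submodule.map_le_iff_le_comap, filtration, filtration, Submodule.map_smul'',
    Submodule.map_top]
  calc m ^ (n - (i + 1)) • LinearMap.range (F.d i)
      ≤ m ^ (n - (i + 1)) • (m • ⊤) := smul_mono_right _ (F.minimal i)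
    _ = m ^ (n - (i + 1) + 1) • ⊤ := by rw [← Submodule.mul_smul, ← pow_succ]
    _ ≤ m ^ (n - i) • ⊤ := Submodule.smul_mono_left (Ideal.pow_le_pow_right (by omega))

/-- The differential as a map `(𝒢ⁿ F)_(i + 1) → (𝒢ⁿ F)_i`. -/
def filtrationD (F : MinimalFreeResolution m M) (n i : ℕ) :
    F.filtration n (i + 1) →ₗ[R] F.filtration n i :=
  (F.d i).restrict (F.filtration_le_comap n i)

/-- `filtrationD` maps `(𝒢ⁿ⁺¹ F)_(i + 1)` into `(𝒢ⁿ⁺¹ F)_i`. -/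
theorem submoduleOf_le_comap (F : MinimalFreeResolution m M) (n i : ℕ) :
    (F.filtration (n + 1) (i + 1)).submoduleOf (F.filtration n (i + 1)) ≤
      ((F.filtration (n + 1) i).submoduleOf (F.filtration n i)).comap (F.filtrationD n i) :=
  fun _ hx => F.filtration_le_comap (n + 1) i hx

/-- The linear part of `F` is the associated graded complex of `F` for the filtration `𝒢`. Its
term in homological degree `i` is `⨁ n, linPart n i`, with
`linPart n i = (𝒢ⁿ F)_i / (𝒢ⁿ⁺¹ F)_i`. (For `n < 0` this quotient would be `0`.) -/
abbrev linPart (F : MinimalFreeResolution m M) (n i : ℕ) : Type u :=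
  F.filtration n i ⧸ (F.filtration (n + 1) i).submoduleOf (F.filtration n i)

/-- The differential of the linear part, in internal degree `n`. -/
def linPartD (F : MinimalFreeResolution m M) (n i : ℕ) :
    F.linPart n (i + 1) →ₗ[R] F.linPart n i :=
  Submodule.mapQ _ _ (F.filtrationD n i) (F.submoduleOf_le_comap n i)

/-- The cycles of the linear part in homological degree `i` and internal degree `n`. -/
def linCycles (F : MinimalFreeResolution m M) (n : ℕ) : ∀ i : ℕ, Submodule R (F.linPart n i)
  | 0 => ⊤
  | i + 1 => LinearMap.ker (F.linPartD n i)

/-- The boundaries of the linear part in homological degree `i` and internal degree `n`. -/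
def linBoundaries (F : MinimalFreeResolution m M) (n i : ℕ) : Submodule R (F.linPart n i) :=
  LinearMap.range (F.linPartD n i)

/-- The homology of the linear part in homological degree `i` and internal degree `n`. -/
abbrev linHomology (F : MinimalFreeResolution m M) (n i : ℕ) : Type u :=
  F.linCycles n i ⧸ (F.linBoundaries n i).submoduleOf (F.linCycles n i)

/-- `sup {i : H_i (lin F) ≠ 0}`, where the supremum of the empty set is `0`. Here
`H_i (lin F) = ⨁ n, linHomology n i`. -/
def linDefect (F : MinimalFreeResolution m M) : ℕ∞ :=
  ⨆ i ∈ {i : ℕ | ∃ n : ℕ, Nontrivial (F.linHomology n i)}, (i : ℕ∞)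

end MinimalFreeResolution

/-- The linearity defect of a finitely generated module over a noetherian local ring:
`sup {i : H_i (lin F) ≠ 0}` for the minimal free resolution `F` of `M`. The latter exists and is
unique up to isomorphism, so that the outer supremum is that of a constant family. -/
def lind (R : Type u) [CommRing R] [IsLocalRing R] (M : Type v) [AddCommGroup M] [Module R M] :
    ℕ∞ :=
  ⨆ F : MinimalFreeResolution (IsLocalRing.maximalIdeal R) M, F.linDefect

/-- The projective dimension of a module; it is `⊥` for the zero module only. -/
abbrev projdim (R : Type u) [CommRing R] (M : Type u) [AddCommGroup M] [Module R M] :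
    WithBot ℕ∞ :=
  CategoryTheory.projectiveDimension (ModuleCat.of R M)

/-! ### The graded case -/

/-- `A = ⨁ n, 𝒜 n` is a standard graded algebra over the field `k`: `A₀ = k`, and `A` is generated
as a `k`-algebra by `A₁`, which has finite dimension over `k`. -/
structure IsStandardGraded {k : Type w} [Field k] {A : Type u} [CommRing A] [Algebra k A]
    (𝒜 : ℕ → Submodule k A) [GradedAlgebra 𝒜] : Prop where
  nontrivial : Nontrivial A
  zero_eq : 𝒜 0 = LinearMap.range (Algebra.linearMap k A)
  finite_one : Module.Finite k (𝒜 1)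
  adjoin_one : Algebra.adjoin k (𝒜 1 : Set A) = ⊤

/-- `M = ⨁ n, ℳ n` is a `ℤ`-graded module over the graded ring `A = ⨁ n, 𝒜 n`. -/
structure IsGradedModule {k : Type w} [Field k] {A : Type u} [CommRing A] [Algebra k A]
    (𝒜 : ℕ → Submodule k A) {M : Type v} [AddCommGroup M] [Module A M]
    (ℳ : ℤ → AddSubgroup M) : Prop where
  isInternal : DirectSum.IsInternal ℳ
  smul_mem : ∀ (i : ℕ) (j : ℤ) (a : A) (x : M), a ∈ 𝒜 i → x ∈ ℳ j → a • x ∈ ℳ (i + j)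

/-- The homogeneous component of `A` of degree `n`, for an integer `n`; it is `0` for `n < 0`. -/
def intPiece {k : Type w} [Field k] {A : Type u} [CommRing A] [Algebra k A]
    (𝒜 : ℕ → Submodule k A) : ℤ → Submodule k A
  | Int.ofNat n => 𝒜 n
  | Int.negSucc _ => ⊥

/-- A minimal free resolution is graded if, for suitable integers `a i j`, its augmentation and its
differentials are homogeneous of degree `0` when `F i` is the graded module `⨁ j, A(- a i j)`, that
is, when the `j`-th basis vector of `F i` has degree `a i j`. -/
def MinimalFreeResolution.IsGraded {k : Type w} [Field k] {A : Type u} [CommRing A] [Algebra k A]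
    (𝒜 : ℕ → Submodule k A) {M : Type v} [AddCommGroup M] [Module A M]
    (ℳ : ℤ → AddSubgroup M) {m : Ideal A} (F : MinimalFreeResolution m M) : Prop :=
  ∃ a : ∀ i : ℕ, Fin (F.rank i) → ℤ,
    (∀ j, F.ε (Pi.single j 1) ∈ ℳ (a 0 j)) ∧
    ∀ i j l, F.d i (Pi.single j 1) l ∈ intPiece 𝒜 (a (i + 1) j - a i l)

/-- The linearity defect of a finitely generated graded module over a standard graded algebra:
`sup {i : H_i (lin F) ≠ 0}` for the minimal graded free resolution `F` of `M`. The latter exists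
and is unique up to isomorphism, so that the outer supremum is that of a constant family. -/
def gradedLind {k : Type w} [Field k] {A : Type u} [CommRing A] [Algebra k A]
    (𝒜 : ℕ → Submodule k A) [GradedAlgebra 𝒜] {M : Type v} [AddCommGroup M] [Module A M]
    (ℳ : ℤ → AddSubgroup M) : ℕ∞ :=
  ⨆ F : {F : MinimalFreeResolution (HomogeneousIdeal.irrelevant 𝒜).toIdeal M // F.IsGraded 𝒜 ℳ},
    F.1.linDefect

end

/-! The linearity defect can be read off from maps between Tor modules: `ld M ≤ d` if and only if
`Tor_i(R/m^(q+1), M) → Tor_i(R/m^q, M)` is zero for all `i > d` and all `q` (`linDefect_le_iff`). On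
a minimal resolution this vanishing says that `∂x ∈ m^(q+1) F_(i-1)` forces `x ∈ m^q F_i +
∂F_(i+1)`; successive approximation turns it into exactness of the linear part.

Let `X → Y → Z` be three consecutive terms of the long exact Tor sequence, and let `I ≤ L ≤ J`. If
the map from `R/I` to `R/L` vanishes on `Z` and the map from `R/L` to `R/J` vanishes on `X`, then
the composite vanishes on `Y`. The lemmas `middle`, `right`, `left` are the cases where `Y` belongs
to `P`, `N`, `M`. For the inequalities, `L` is `m^q` or `m^(q+1)`, so that one of the two maps is an
identity; it vanishes because the Tor modules do, above the projective dimension. The other map is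
controlled by a linearity defect. Statements (a) and (b) follow from these bounds.

Tor enters only through dimension shifting, so independence of the chosen presentations has to be
proved. The criterion does not mention the resolution, hence all minimal resolutions have the same
defect, and only their existence remains: each syzygy is covered by a smallest family of
(homogeneous) generators. -/

/-! ### Vanishing of the maps `Tor (R / I, M) → Tor (R / J, M)` -/

/-- The map `Tor_(n + 1) (R / I, M) → Tor_(n + 1) (R / J, M)` is zero, for ideals `I ≤ J`. This is
expressed by dimension shifting, as `Tor_1 (R / I, M) = (K ∩ I F) / I K` for a short exact sequence
`0 → K → F → M → 0` with `F` projective. -/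
def TorMapZero {R : Type u} [CommRing R] (I J : Ideal R) :
    ℕ → ∀ (M : Type u) [AddCommGroup M] [Module R M], Prop
  | 0, M, _, _ => ∀ (F : Type u) [AddCommGroup F] [Module R F] [Module.Projective R F]
      (p : F →ₗ[R] M), Function.Surjective p →
        ∀ x : LinearMap.ker p, (x : F) ∈ I • (⊤ : Submodule R F) →
          x ∈ J • (⊤ : Submodule R (LinearMap.ker p))
  | n + 1, M, _, _ => ∀ (F : Type u) [AddCommGroup F] [Module R F] [Module.Projective R F]
      (p : F →ₗ[R] M), Function.Surjective p → TorMapZero I J n (LinearMap.ker p)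

section TorMapZero

variable {R : Type u} [CommRing R]

theorem LinearMap.apply_mem_smul_top {X Y : Type*} [AddCommGroup X] [Module R X] [AddCommGroup Y]
    [Module R Y] (f : X →ₗ[R] Y) {I : Ideal R} {x : X} (hx : x ∈ I • (⊤ : Submodule R X)) :
    f x ∈ I • (⊤ : Submodule R Y) := by
  have h := Submodule.mem_map_of_mem (f := f) hx
  rw [Submodule.map_smul''] at h
  exact (smul_mono_right I le_top : I • Submodule.map f ⊤ ≤ I • ⊤) h

theorem LinearMap.exists_mem_smul_top {X Y : Type*} [AddCommGroup X] [Module R X] [AddCommGroup Y]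
    [Module R Y] (f : X →ₗ[R] Y) (hf : Function.Surjective f) {I : Ideal R} {y : Y}
    (hy : y ∈ I • (⊤ : Submodule R Y)) : ∃ x ∈ I • (⊤ : Submodule R X), f x = y := by
  rw [← LinearMap.range_eq_top.mpr hf, ← Submodule.map_top, ← Submodule.map_smul''] at hy
  exact hy

theorem exists_projective_cover (M : Type u) [AddCommGroup M] [Module R M] :
    ∃ (F : Type u) (_ : AddCommGroup F) (_ : Module R F) (_ : Module.Projective R F)
      (p : F →ₗ[R] M), Function.Surjective p :=
  ⟨M →₀ R, inferInstance, inferInstance, inferInstance, Finsupp.linearCombination R id,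
    Finsupp.linearCombination_id_surjective R M⟩

/-! ### Independence of the presentation -/

section

variable {M M' Q F F' : Type u} [AddCommGroup M] [Module R M] [AddCommGroup M'] [Module R M']
  [AddCommGroup Q] [Module R Q] [AddCommGroup F] [Module R F] [AddCommGroup F'] [Module R F']

/-- If `M'` is a retract of `M` up to maps factoring through projective modules, then the same holds
for their syzygies. -/
theorem exists_stable_retract_ker [Module.Projective R Q] [Module.Projective R F]
    [Module.Projective R F'] (f : M' →ₗ[R] M) (g : M →ₗ[R] M') (α : M' →ₗ[R] Q) (β : Q →ₗ[R] M')
    (h : ∀ x, x = g (f x) + β (α x)) (p : F →ₗ[R] M) (hp : Function.Surjective p)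
    (p' : F' →ₗ[R] M') (hp' : Function.Surjective p') :
    ∃ (f₁ : F' →ₗ[R] F) (f₂ : LinearMap.ker p' →ₗ[R] LinearMap.ker p)
      (g₂ : LinearMap.ker p →ₗ[R] LinearMap.ker p') (β₂ : F' →ₗ[R] LinearMap.ker p'),
      (∀ x, (f₂ x : F) = f₁ x) ∧ ∀ x, x = g₂ (f₂ x) + β₂ ((LinearMap.ker p').subtype x) := by
  obtain ⟨f₁, hf₁⟩ := Module.projective_lifting_property p (f ∘ₗ p') hp
  obtain ⟨g₁, hg₁⟩ := Module.projective_lifting_property p' (g ∘ₗ p) hp'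
  obtain ⟨γ, hγ⟩ := Module.projective_lifting_property p' β hp'
  have hf₁' (x) : p (f₁ x) = f (p' x) := LinearMap.congr_fun hf₁ x
  have hg₁' (x) : p' (g₁ x) = g (p x) := LinearMap.congr_fun hg₁ x
  have hγ' (x) : p' (γ x) = β x := LinearMap.congr_fun hγ x
  -- The error `x - g₁ (f₁ x) - γ (α (p' x))` lies in `ker p'` for every `x` in `F'`, by `h`. On
  -- `ker p'` its last term disappears, so it is the required correction, and it extends to the
  -- projective module `F'`.
  refine ⟨f₁, f₁.restrict fun x hx => ?_, g₁.restrict fun x hx => ?_,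
    (LinearMap.id - g₁ ∘ₗ f₁ - γ ∘ₗ α ∘ₗ p').codRestrict _ fun x => ?_, fun x => rfl, fun x => ?_⟩
  · rw [LinearMap.mem_ker] at hx ⊢
    rw [hf₁', hx, map_zero]
  · rw [LinearMap.mem_ker] at hx ⊢
    rw [hg₁', hx, map_zero]
  · have hx : p' x = 0 := x.2
    ext
    simp [hx]
  · have := h (p' x)
    simp only [LinearMap.mem_ker, LinearMap.sub_apply, LinearMap.id_apply, LinearMap.comp_apply,
      map_sub, hf₁', hg₁', hγ']
    nth_rewrite 1 [this]
    abel

end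

namespace TorMapZero

variable {I L J : Ideal R}

/-- The correction term is defined on all of `F'`, so it carries `I F'` into `I (ker p') ≤ J (ker
p')`; the rest goes through the given presentation of `M`. One presentation of `M` thus controls all
presentations of `M'`. -/
theorem zero_of_stable_retract {M M' Q F : Type u} [AddCommGroup M] [Module R M] [AddCommGroup M']
    [Module R M'] [AddCommGroup Q] [Module R Q] [AddCommGroup F] [Module R F]
    [Module.Projective R Q] [Module.Projective R F] (hIJ : I ≤ J)
    (f : M' →ₗ[R] M) (g : M →ₗ[R] M') (α : M' →ₗ[R] Q) (β : Q →ₗ[R] M')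
    (h : ∀ x, x = g (f x) + β (α x)) (p : F →ₗ[R] M) (hp : Function.Surjective p)
    (H : ∀ x : LinearMap.ker p, (x : F) ∈ I • (⊤ : Submodule R F) →
          x ∈ J • (⊤ : Submodule R (LinearMap.ker p))) : TorMapZero I J 0 M' := by
  intro F' _ _ _ p' hp' x hx
  obtain ⟨f₁, f₂, g₂, β₂, h₁, h₂⟩ := exists_stable_retract_ker f g α β h p hp p' hp'
  rw [h₂ x]
  refine add_mem (g₂.apply_mem_smul_top (H _ ?_)) ?_
  · rw [h₁]
    exact f₁.apply_mem_smul_top hx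
  · exact Submodule.smul_mono_left hIJ (β₂.apply_mem_smul_top hx)

theorem of_stable_retract (hIJ : I ≤ J) (n : ℕ) :
    ∀ {M M' Q : Type u} [AddCommGroup M] [Module R M] [AddCommGroup M'] [Module R M']
      [AddCommGroup Q] [Module R Q] [Module.Projective R Q]
      (f : M' →ₗ[R] M) (g : M →ₗ[R] M') (α : M' →ₗ[R] Q) (β : Q →ₗ[R] M')
      (_ : ∀ x, x = g (f x) + β (α x)), TorMapZero I J n M → TorMapZero I J n M' := by
  induction n with
  | zero =>
    intro M M' Q _ _ _ _ _ _ _ f g α β h H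
    obtain ⟨F, _, _, _, p, hp⟩ := exists_projective_cover (R := R) M
    exact zero_of_stable_retract hIJ f g α β h p hp (H F p hp)
  | succ n ih =>
    intro M M' Q _ _ _ _ _ _ _ f g α β h H F' _ _ _ p' hp'
    obtain ⟨F, _, _, _, p, hp⟩ := exists_projective_cover (R := R) M
    obtain ⟨f₁, f₂, g₂, β₂, h₁, h₂⟩ := exists_stable_retract_ker f g α β h p hp p' hp'
    exact ih f₂ g₂ _ β₂ h₂ (H F p hp)

variable {M P N F : Type u} [AddCommGroup M] [Module R M] [AddCommGroup P] [Module R P]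
  [AddCommGroup N] [Module R N] [AddCommGroup F] [Module R F]

theorem zero_iff [Module.Projective R F] (hIJ : I ≤ J) (p : F →ₗ[R] M)
    (hp : Function.Surjective p) :
    TorMapZero I J 0 M ↔ ∀ x : LinearMap.ker p, (x : F) ∈ I • (⊤ : Submodule R F) →
      x ∈ J • (⊤ : Submodule R (LinearMap.ker p)) :=
  ⟨fun H => H F p hp, fun H => zero_of_stable_retract (Q := F) hIJ LinearMap.id LinearMap.id 0 0
    (fun x => by simp) p hp H⟩

/-- Two syzygies of the same module are retracts of each other up to projectives (lift the
identity), so one presentation suffices. -/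
theorem succ_iff [Module.Projective R F] (hIJ : I ≤ J) (n : ℕ) (p : F →ₗ[R] M)
    (hp : Function.Surjective p) :
    TorMapZero I J (n + 1) M ↔ TorMapZero I J n (LinearMap.ker p) := by
  refine ⟨fun H => H F p hp, fun H F' _ _ _ p' hp' => ?_⟩
  obtain ⟨f₁, f₂, g₂, β₂, h₁, h₂⟩ := exists_stable_retract_ker (Q := F) LinearMap.id LinearMap.id
    (0 : M →ₗ[R] F) 0 (fun x => by simp) p hp p' hp'
  exact of_stable_retract hIJ n f₂ g₂ _ β₂ h₂ H

theorem of_projective (hIJ : I ≤ J) (n : ℕ) :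
    ∀ (M : Type u) [AddCommGroup M] [Module R M] [Module.Projective R M], TorMapZero I J n M := by
  -- A section of `p` splits the inclusion of `ker p` into `F`.
  have key : ∀ (M F : Type u) [AddCommGroup M] [Module R M] [Module.Projective R M]
      [AddCommGroup F] [Module R F] (p : F →ₗ[R] M), Function.Surjective p →
      ∃ r : F →ₗ[R] LinearMap.ker p, r ∘ₗ (LinearMap.ker p).subtype = LinearMap.id := by
    intro M F _ _ _ _ _ p hp
    obtain ⟨s, hs⟩ := Module.projective_lifting_property p LinearMap.id hp
    have hs' (x) : p (s x) = x := LinearMap.congr_fun hs x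
    refine ⟨(LinearMap.id - s ∘ₗ p).codRestrict _ fun x => by simp [hs'], ?_⟩
    ext x
    have hx : p x = 0 := x.2
    simp [hx]
  induction n with
  | zero =>
    intro M _ _ _ F _ _ _ p hp x hx
    obtain ⟨r, hr⟩ := key M F p hp
    have hrx : r x = x := LinearMap.congr_fun hr x
    rw [← hrx]
    exact Submodule.smul_mono_left hIJ (r.apply_mem_smul_top hx)
  | succ n ih =>
    intro M _ _ _ F _ _ _ p hp
    obtain ⟨r, hr⟩ := key M F p hp
    have := Module.Projective.of_split _ _ hr
    exact ih _

/-- Projective dimension at most `n` kills `Tor_(n + 1)`. The case `I = J` is allowed and expresses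
exactly this vanishing. -/
theorem of_hasProjectiveDimensionLT (hIJ : I ≤ J) (n : ℕ) :
    ∀ (M : Type u) [AddCommGroup M] [Module R M]
      (_ : CategoryTheory.HasProjectiveDimensionLT (ModuleCat.of R M) (n + 1)),
      TorMapZero I J n M := by
  induction n with
  | zero =>
    intro M _ _ h
    have := (IsProjective.iff_projective (R := R) M).mpr inferInstance
    exact of_projective hIJ 0 M
  | succ n ih =>
    intro M _ _ h F _ _ _ p hp
    refine ih _ ?_
    let S : CategoryTheory.ShortComplex (ModuleCat R) :=
      .mk (ModuleCat.ofHom (LinearMap.ker p).subtype) (ModuleCat.ofHom p) (by ext x; exact x.2)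
    have hS : S.ShortExact :=
      { exact := by
          rw [CategoryTheory.ShortComplex.moduleCat_exact_iff]
          intro x hx
          exact ⟨⟨x, hx⟩, rfl⟩
        mono_f := (ModuleCat.mono_iff_injective _).mpr (LinearMap.ker p).injective_subtype
        epi_g := (ModuleCat.epi_iff_surjective _).mpr hp }
    exact (hS.hasProjectiveDimensionLT_X₃_iff n
      ((IsProjective.iff_projective (R := R) F).mp inferInstance)).mp h

/-! ### Short exact sequences -/

/-- The horseshoe lemma in degrees zero and one. -/
theorem _root_.exists_horseshoe (φ : M →ₗ[R] P) (lam : P →ₗ[R] N) (hφ : Function.Injective φ)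
    (hex : Function.Exact φ lam) (hlam : Function.Surjective lam) {G : Type u} [AddCommGroup G]
    [Module R G] [Module.Projective R G] (p : F →ₗ[R] M) (hp : Function.Surjective p)
    (s : G →ₗ[R] N) (hs : Function.Surjective s) :
    ∃ (t : F × G →ₗ[R] P) (i : LinearMap.ker p →ₗ[R] LinearMap.ker t)
      (π : LinearMap.ker t →ₗ[R] LinearMap.ker s), Function.Surjective t ∧
      Function.Injective i ∧ Function.Exact i π ∧ Function.Surjective π ∧
      (∀ x, (i x : F × G) = ((x : F), 0)) ∧ ∀ x, (π x : G) = (x : F × G).2 := by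
  obtain ⟨σ, hσ⟩ := Module.projective_lifting_property lam s hlam
  have hσ' (x) : lam (σ x) = s x := LinearMap.congr_fun hσ x
  have hlift : ∀ (y : G) (z : P), lam z = s y → ∃ x : F, φ (p x) + σ y = z := by
    intro y z hz
    obtain ⟨x, hx⟩ := (hex (z - σ y)).mp (by rw [map_sub, hσ', hz, sub_self])
    obtain ⟨x, rfl⟩ := hp x
    exact ⟨x, by rw [hx, sub_add_cancel]⟩
  refine ⟨(φ ∘ₗ p).coprod σ, (LinearMap.inl R F G).restrict fun x hx => ?_,
    (LinearMap.snd R F G).restrict fun x hx => ?_, fun z => ?_, fun x y hxy => ?_, fun x => ?_,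
    fun y => ?_, fun x => rfl, fun x => rfl⟩
  · rw [LinearMap.mem_ker] at hx ⊢
    simp [hx]
  · rw [LinearMap.mem_ker] at hx ⊢
    have := congrArg lam hx
    simpa [hσ', hex.apply_apply_eq_zero] using this
  · obtain ⟨y, hy⟩ := hs (lam z)
    obtain ⟨x, hx⟩ := hlift y z hy.symm
    exact ⟨(x, y), hx⟩
  · exact Subtype.ext (congrArg (fun z : LinearMap.ker ((φ ∘ₗ p).coprod σ) => (z : F × G).1) hxy)
  · constructor
    · intro hx
      have h2 : (x : F × G).2 = 0 := congrArg Subtype.val hx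
      have h1 : (φ ∘ₗ p).coprod σ (x : F × G) = 0 := x.2
      rw [LinearMap.coprod_apply, h2, map_zero, add_zero, LinearMap.comp_apply,
        map_eq_zero_iff φ hφ] at h1
      exact ⟨⟨_, h1⟩, Subtype.ext (Prod.ext rfl h2.symm)⟩
    · rintro ⟨y, rfl⟩
      exact Subtype.ext rfl
  · obtain ⟨x, hx⟩ := hlift y 0 (by rw [map_zero]; exact y.2.symm)
    exact ⟨⟨(x, y), hx⟩, Subtype.ext rfl⟩

/-- The horseshoe lemma reduces to `n = 0`. There a class on `P` has image zero on `N` after passing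
to `L`, so up to an element of `L (ker t)` it comes from a class on `M`, which dies on passing to
`J`. -/
theorem middle (hIL : I ≤ L) (hLJ : L ≤ J) (n : ℕ) :
    ∀ {M P N : Type u} [AddCommGroup M] [Module R M] [AddCommGroup P] [Module R P]
      [AddCommGroup N] [Module R N] (φ : M →ₗ[R] P) (lam : P →ₗ[R] N)
      (_ : Function.Injective φ) (_ : Function.Exact φ lam) (_ : Function.Surjective lam),
      TorMapZero I L n N → TorMapZero L J n M → TorMapZero I J n P := by
  induction n with
  | zero =>
    intro M P N _ _ _ _ _ _ φ lam hφ hex hlam HN HM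
    obtain ⟨F, _, _, _, p, hp⟩ := exists_projective_cover (R := R) M
    obtain ⟨G, _, _, _, s, hs⟩ := exists_projective_cover (R := R) N
    obtain ⟨t, i, π, ht, -, hiπ, hπ, hi', hπ'⟩ := exists_horseshoe φ lam hφ hex hlam p hp s hs
    refine (zero_iff (hIL.trans hLJ) t ht).mpr fun x hx => ?_
    obtain ⟨y, hy, hyx⟩ := π.exists_mem_smul_top hπ (HN G s hs (π x) (by
      rw [hπ']
      exact (LinearMap.snd R F G).apply_mem_smul_top hx))
    obtain ⟨z, hz⟩ := (hiπ (x - y)).mp (by rw [map_sub, hyx, sub_self])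
    have hzL : (z : F) ∈ L • (⊤ : Submodule R F) := by
      have h1 : (z : F) = (LinearMap.fst R F G) (x : F × G) -
          ((LinearMap.fst R F G) ∘ₗ (LinearMap.ker t).subtype) y := by
        have := congrArg (fun a : LinearMap.ker t => (a : F × G).1) hz
        simpa [hi'] using this
      rw [h1]
      exact sub_mem (Submodule.smul_mono_left hIL (LinearMap.apply_mem_smul_top _ hx))
        (LinearMap.apply_mem_smul_top _ hy)
    rw [← sub_add_cancel x y, ← hz]
    exact add_mem (i.apply_mem_smul_top (HM F p hp z hzL)) (Submodule.smul_mono_left hLJ hy)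
  | succ n ih =>
    intro M P N _ _ _ _ _ _ φ lam hφ hex hlam HN HM
    obtain ⟨F, _, _, _, p, hp⟩ := exists_projective_cover (R := R) M
    obtain ⟨G, _, _, _, s, hs⟩ := exists_projective_cover (R := R) N
    obtain ⟨t, i, π, ht, hi, hiπ, hπ, -⟩ := exists_horseshoe φ lam hφ hex hlam p hp s hs
    exact (succ_iff (hIL.trans hLJ) n t ht).mpr (ih i π hi hiπ hπ (HN G s hs) (HM F p hp))

/-- For a cover `p` of `P`, `ker (lam ∘ₗ p)` is a syzygy of `N` and an extension of `M` by the
syzygy `ker p` of `P`, so `middle` applies. -/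
theorem right (hIL : I ≤ L) (hLJ : L ≤ J) (n : ℕ) (φ : M →ₗ[R] P) (lam : P →ₗ[R] N)
    (hφ : Function.Injective φ) (hex : Function.Exact φ lam) (hlam : Function.Surjective lam)
    (HM : TorMapZero I L n M) (HP : TorMapZero L J (n + 1) P) : TorMapZero I J (n + 1) N := by
  obtain ⟨F, _, _, _, p, hp⟩ := exists_projective_cover (R := R) P
  let e := LinearEquiv.ofInjective φ hφ
  have he (x) (hx : lam x = 0) : ∃ y, φ y = x := (hex x).mp hx
  let π : LinearMap.ker (lam ∘ₗ p) →ₗ[R] M := e.symm.toLinearMap ∘ₗ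
    (p.restrict (p := LinearMap.ker (lam ∘ₗ p)) (q := LinearMap.range φ) fun x hx => he _ hx)
  have hπ (x) : φ (π x) = p x := congrArg Subtype.val (e.apply_symm_apply _)
  refine (succ_iff (hIL.trans hLJ) n (lam ∘ₗ p) (hlam.comp hp)).mpr
    (middle hIL hLJ n (Submodule.inclusion (LinearMap.ker_le_ker_comp p lam)) π
      (Submodule.inclusion_injective _) (fun x => ?_) (fun y => ?_) HM (HP F p hp))
  · constructor
    · intro hx
      exact ⟨⟨x, by rw [LinearMap.mem_ker, ← hπ, hx, map_zero]⟩, rfl⟩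
    · rintro ⟨y, rfl⟩
      exact hφ (by rw [hπ, map_zero]; exact y.2)
  · obtain ⟨x, hx⟩ := hp (φ y)
    exact ⟨⟨x, by simp [hx, hex.apply_apply_eq_zero]⟩, hφ (by rw [hπ, hx])⟩

/-- The kernel of `M/LM → P/LP` is the image of `Tor_1(R/L, N)`; by naturality it dies in `M/JM`. -/
theorem mem_smul_top_of_apply_mem (hLJ : L ≤ J) (φ : M →ₗ[R] P) (lam : P →ₗ[R] N)
    (hφ : Function.Injective φ) (hex : Function.Exact φ lam) (hlam : Function.Surjective lam)
    (H : TorMapZero L J 0 N) {x : M} (hx : φ x ∈ L • (⊤ : Submodule R P)) :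
    x ∈ J • (⊤ : Submodule R M) := by
  obtain ⟨G, _, _, _, s, hs⟩ := exists_projective_cover (R := R) N
  obtain ⟨σ, hσ⟩ := Module.projective_lifting_property lam s hlam
  have hσ' (x) : lam (σ x) = s x := LinearMap.congr_fun hσ x
  have hsurj : Function.Surjective (φ.coprod σ) := by
    intro z
    obtain ⟨y, hy⟩ := hs (lam z)
    obtain ⟨a, ha⟩ := (hex (z - σ y)).mp (by rw [map_sub, hσ', hy, sub_self])
    exact ⟨(a, y), by simp [ha]⟩
  obtain ⟨⟨a, g⟩, hag, hax⟩ := (φ.coprod σ).exists_mem_smul_top hsurj hx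
  rw [LinearMap.coprod_apply] at hax
  have hg : s g = 0 := by
    have := congrArg lam hax
    simpa [hσ', hex.apply_apply_eq_zero] using this
  have hgJ := H G s hs ⟨g, hg⟩ ((LinearMap.snd R M G).apply_mem_smul_top hag)
  let e := LinearEquiv.ofInjective φ hφ
  let τ : LinearMap.ker s →ₗ[R] M := e.symm.toLinearMap ∘ₗ
    (σ.restrict (p := LinearMap.ker s) (q := LinearMap.range φ) fun x hx =>
      (hex _).mp (by rw [hσ']; exact hx))
  have hτ (x) : φ (τ x) = σ x := congrArg Subtype.val (e.apply_symm_apply _)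
  have : x = a + τ ⟨g, hg⟩ := hφ (by rw [map_add, hτ, hax])
  rw [this]
  exact add_mem (Submodule.smul_mono_left hLJ ((LinearMap.fst R M G).apply_mem_smul_top hag))
    (τ.apply_mem_smul_top hgJ)

/-- In the base case the connecting map from `Tor_2` of `N` is that from `Tor_1` of its syzygy, so
the previous lemma is applied to the sequence of first syzygies. -/
theorem left (hIL : I ≤ L) (hLJ : L ≤ J) (n : ℕ) :
    ∀ {M P N : Type u} [AddCommGroup M] [Module R M] [AddCommGroup P] [Module R P]
      [AddCommGroup N] [Module R N] (φ : M →ₗ[R] P) (lam : P →ₗ[R] N)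
      (_ : Function.Injective φ) (_ : Function.Exact φ lam) (_ : Function.Surjective lam),
      TorMapZero I L n P → TorMapZero L J (n + 1) N → TorMapZero I J n M := by
  induction n with
  | zero =>
    intro M P N _ _ _ _ _ _ φ lam hφ hex hlam HP HN
    obtain ⟨F, _, _, _, p, hp⟩ := exists_projective_cover (R := R) M
    obtain ⟨G, _, _, _, s, hs⟩ := exists_projective_cover (R := R) N
    obtain ⟨t, i, π, ht, hi, hiπ, hπ, hi', -⟩ := exists_horseshoe φ lam hφ hex hlam p hp s hs
    refine (zero_iff (hIL.trans hLJ) p hp).mpr fun x hx => ?_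
    refine mem_smul_top_of_apply_mem hLJ i π hi hiπ hπ (HN G s hs) (HP _ t ht _ ?_)
    rw [hi']
    exact (LinearMap.inl R F G).apply_mem_smul_top hx
  | succ n ih =>
    intro M P N _ _ _ _ _ _ φ lam hφ hex hlam HP HN
    obtain ⟨F, _, _, _, p, hp⟩ := exists_projective_cover (R := R) M
    obtain ⟨G, _, _, _, s, hs⟩ := exists_projective_cover (R := R) N
    obtain ⟨t, i, π, ht, hi, hiπ, hπ, -⟩ := exists_horseshoe φ lam hφ hex hlam p hp s hs
    exact (succ_iff (hIL.trans hLJ) n p hp).mpr (ih i π hi hiπ hπ (HP _ t ht) (HN G s hs))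

end TorMapZero

end TorMapZero

/-! ### The linearity defect and the maps between Tor modules -/

theorem ENat.le_of_forall_le_natCast {a b : ℕ∞} (h : ∀ d : ℕ, b ≤ d → a ≤ d) : a ≤ b := by
  cases b with
  | top => exact le_top
  | coe b => exact h b le_rfl

theorem ENat.eq_of_forall_le_natCast_iff {a b : ℕ∞} (h : ∀ d : ℕ, a ≤ d ↔ b ≤ d) : a = b :=
  (le_of_forall_le_natCast fun d => (h d).mpr).antisymm
    (le_of_forall_le_natCast fun d => (h d).mp)

namespace MinimalFreeResolution

variable {R : Type u} [CommRing R] {m : Ideal R}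

theorem _root_.Submodule.mem_pow_smul_top {X : Type*} [AddCommGroup X] [Module R X] (m : Ideal R)
    {n : ℕ} (hn : n = 0) (x : X) : x ∈ m ^ n • (⊤ : Submodule R X) := by
  rw [hn, pow_zero, Ideal.one_eq_top, Submodule.top_smul]
  trivial

theorem d_d {M : Type v} [AddCommGroup M] [Module R M] (F : MinimalFreeResolution m M) (i : ℕ)
    (x : Fin (F.rank (i + 2)) → R) : F.d i (F.d (i + 1) x) = 0 :=
  (F.exact_succ i).apply_apply_eq_zero x

theorem linHomology_subsingleton_iff {M : Type v} [AddCommGroup M] [Module R M]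
    (F : MinimalFreeResolution m M) (n j : ℕ) :
    Subsingleton (F.linHomology n (j + 1)) ↔
      ∀ x ∈ F.filtration n (j + 1), F.d j x ∈ F.filtration (n + 1) j →
        ∃ y ∈ F.filtration n (j + 2), x - F.d (j + 1) y ∈ F.filtration (n + 1) (j + 1) := by
  have h : Subsingleton (F.linHomology n (j + 1)) ↔
      F.linCycles n (j + 1) ≤ F.linBoundaries n (j + 1) :=
    Submodule.Quotient.subsingleton_iff.trans Submodule.comap_subtype_eq_top
  rw [h]
  constructor
  · intro h x hx hdx
    obtain ⟨y, hy⟩ := h (x := Submodule.Quotient.mk ⟨x, hx⟩)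
      ((Submodule.Quotient.mk_eq_zero _).mpr hdx)
    obtain ⟨⟨y, hy'⟩, rfl⟩ := Submodule.Quotient.mk_surjective _ y
    exact ⟨y, hy', (Submodule.Quotient.eq
      ((F.filtration (n + 1) (j + 1)).submoduleOf (F.filtration n (j + 1)))).mp hy.symm⟩
  · rintro h x hx
    obtain ⟨⟨x, hx'⟩, rfl⟩ := Submodule.Quotient.mk_surjective _ x
    obtain ⟨y, hy, hxy⟩ := h x hx' ((Submodule.Quotient.mk_eq_zero
      ((F.filtration (n + 1) j).submoduleOf (F.filtration n j))).mp hx)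
    exact ⟨Submodule.Quotient.mk ⟨y, hy⟩, ((Submodule.Quotient.eq
      ((F.filtration (n + 1) (j + 1)).submoduleOf (F.filtration n (j + 1)))).mpr hxy).symm⟩

theorem linDefect_le_iff_linHomology {M : Type v} [AddCommGroup M] [Module R M]
    (F : MinimalFreeResolution m M) (d : ℕ) :
    F.linDefect ≤ d ↔ ∀ j ≥ d, ∀ n, Subsingleton (F.linHomology n (j + 1)) := by
  simp only [linDefect, iSup_le_iff, Set.mem_ofPred_eq, Nat.cast_le]
  constructor
  · intro h j hj n
    by_contra hn
    have := h (j + 1) ⟨n, not_subsingleton_iff_nontrivial.mp hn⟩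
    omega
  · rintro h i ⟨n, hn⟩
    by_contra hi
    obtain ⟨j, rfl⟩ : ∃ j, i = j + 1 := ⟨i - 1, by omega⟩
    exact not_nontrivial_iff_subsingleton.mpr (h j (by omega) n) hn

/-- This removes the filtration degree: exactness of the linear part improves `x` modulo boundaries
by one power of `m` at a time. -/
theorem linDefect_le_iff_d {M : Type v} [AddCommGroup M] [Module R M]
    (F : MinimalFreeResolution m M) (d : ℕ) :
    F.linDefect ≤ d ↔ ∀ j ≥ d, ∀ (q : ℕ) (x : Fin (F.rank (j + 1)) → R),
      F.d j x ∈ m ^ (q + 1) • (⊤ : Submodule R (Fin (F.rank j) → R)) →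
        ∃ y, x - F.d (j + 1) y ∈ m ^ q • (⊤ : Submodule R (Fin (F.rank (j + 1)) → R)) := by
  simp only [linDefect_le_iff_linHomology, linHomology_subsingleton_iff, filtration]
  constructor
  · intro h j hj q x hx
    suffices ∀ s ≤ q, ∃ y,
        x - F.d (j + 1) y ∈ m ^ s • (⊤ : Submodule R (Fin (F.rank (j + 1)) → R)) from this q le_rfl
    intro s
    induction s with
    | zero => exact fun _ => ⟨0, Submodule.mem_pow_smul_top m rfl _⟩
    | succ s ih =>
      intro hs
      obtain ⟨y, hy⟩ := ih (by omega)
      have hle : m ^ (q + 1) ≤ m ^ (j + 1 + s + 1 - j) := Ideal.pow_le_pow_right (by omega)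
      obtain ⟨z, -, hz⟩ := h j hj (j + 1 + s) (x - F.d (j + 1) y)
        (by rwa [show j + 1 + s - (j + 1) = s by omega])
        (by rw [map_sub, d_d, sub_zero]; exact Submodule.smul_mono_left hle hx)
      refine ⟨y + z, ?_⟩
      rwa [show j + 1 + s + 1 - (j + 1) = s + 1 by omega, sub_sub, ← map_add] at hz
  · intro h j hj n x hx hdx
    obtain hn | hn := le_or_gt n j
    · exact ⟨0, zero_mem _, Submodule.mem_pow_smul_top m (by omega) _⟩
    obtain ⟨q, rfl⟩ := Nat.exists_eq_add_of_lt hn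
    rw [show j + q + 1 + 1 - j = q + 1 + 1 by omega] at hdx
    rw [show j + q + 1 - (j + 1) = q by omega] at hx
    rw [show j + q + 1 - (j + 2) = q - 1 by omega, show j + q + 1 + 1 - (j + 1) = q + 1 by omega]
    obtain ⟨y, hy⟩ := h j hj (q + 1) x hdx
    cases q with
    | zero => exact ⟨y, Submodule.mem_pow_smul_top m rfl _, hy⟩
    | succ q =>
      -- The preimage `y` must itself lie deep in the filtration. As `∂y` is already in `m ^ (q +
      -- 1)`, the hypothesis one degree higher corrects `y` by a boundary, leaving `∂y` unchanged.
      obtain ⟨w, hw⟩ := h (j + 1) (by omega) q y (by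
        rw [← sub_sub_cancel x (F.d (j + 1) y)]
        exact sub_mem hx (Submodule.smul_mono_left (Ideal.pow_le_pow_right (by omega)) hy))
      exact ⟨_, hw, by rwa [map_sub, d_d, sub_zero]⟩

/-- Allowing an arbitrary cokernel `X` of `F.d i` makes the induction run: the next syzygy is the
cokernel of `F.d (i + 1)`. Elements of `J (ker p)` lift to `J F_(i + 1)` up to the image of `F.d (i
+ 1)`. -/
theorem torMapZero_iff_of_ker_eq {M : Type v} [AddCommGroup M] [Module R M]
    (F : MinimalFreeResolution m M) {I J : Ideal R} (hIJ : I ≤ J) (n : ℕ) :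
    ∀ (i : ℕ) {X : Type u} [AddCommGroup X] [Module R X] (p : (Fin (F.rank i) → R) →ₗ[R] X)
      (_ : Function.Surjective p) (_ : LinearMap.ker p = LinearMap.range (F.d i)),
      TorMapZero I J n X ↔ ∀ x : Fin (F.rank (i + n + 1)) → R,
        F.d (i + n) x ∈ I • (⊤ : Submodule R _) → ∃ y, x - F.d (i + n + 1) y ∈ J • (⊤ : Submodule R _) := by
  have key (i : ℕ) {X : Type u} [AddCommGroup X] [Module R X] (p : (Fin (F.rank i) → R) →ₗ[R] X)
      (hker : LinearMap.ker p = LinearMap.range (F.d i)) :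
      ∃ s : (Fin (F.rank (i + 1)) → R) →ₗ[R] LinearMap.ker p, Function.Surjective s ∧
        (∀ x, (s x : Fin (F.rank i) → R) = F.d i x) ∧
        LinearMap.ker s = LinearMap.range (F.d (i + 1)) := by
    refine ⟨(F.d i).codRestrict _ fun x => hker ▸ ⟨x, rfl⟩, fun ⟨y, hy⟩ => ?_, fun x => rfl, ?_⟩
    · rw [hker] at hy
      obtain ⟨x, rfl⟩ := hy
      exact ⟨x, rfl⟩
    · rw [LinearMap.ker_codRestrict, (F.exact_succ i).linearMap_ker_eq]
  induction n with
  | zero =>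
    intro i X _ _ p hp hker
    obtain ⟨s, hs, hsd, hskers⟩ := key i p hker
    rw [TorMapZero.zero_iff hIJ p hp]
    constructor
    · intro h x hx
      obtain ⟨z, hz, hzx⟩ := s.exists_mem_smul_top hs (h (s x) (by rw [hsd]; exact hx))
      have hxz : x - z ∈ LinearMap.ker s := by rw [LinearMap.mem_ker, map_sub, hzx, sub_self]
      rw [hskers] at hxz
      obtain ⟨y, hy⟩ := hxz
      refine ⟨y, ?_⟩
      rw [hy, sub_sub_cancel]
      exact hz
    · intro h x hx
      obtain ⟨x, rfl⟩ := hs x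
      rw [hsd] at hx
      obtain ⟨y, hy⟩ := h x hx
      have hsy : s (F.d (i + 1) y) = 0 := by
        rw [← LinearMap.mem_ker, hskers]
        exact ⟨y, rfl⟩
      have := s.apply_mem_smul_top hy
      rwa [map_sub, hsy, sub_zero] at this
  | succ n ih =>
    intro i X _ _ p hp hker
    obtain ⟨s, hs, -, hskers⟩ := key i p hker
    rw [TorMapZero.succ_iff hIJ n p hp, ih (i + 1) s hs hskers,
      show i + 1 + n = i + (n + 1) by omega]

theorem linDefect_le_iff {M : Type u} [AddCommGroup M] [Module R M]
    (F : MinimalFreeResolution m M) (d : ℕ) :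
    F.linDefect ≤ d ↔ ∀ n ≥ d, ∀ q, TorMapZero (m ^ (q + 1)) (m ^ q) n M := by
  rw [linDefect_le_iff_d]
  refine forall_congr' fun n => forall_congr' fun _ => forall_congr' fun q => ?_
  rw [F.torMapZero_iff_of_ker_eq (Ideal.pow_le_pow_right q.le_succ) n 0 F.ε F.ε_surjective
    F.exact_zero.linearMap_ker_eq, Nat.zero_add]

theorem linDefect_eq {M : Type u} [AddCommGroup M] [Module R M]
    (F F' : MinimalFreeResolution m M) : F.linDefect = F'.linDefect :=
  ENat.eq_of_forall_le_natCast_iff fun d => by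
    rw [F.linDefect_le_iff, F'.linDefect_le_iff]

end MinimalFreeResolution

/-! ### Inequalities for short exact sequences -/

theorem exists_projdim_eq_coe {R : Type u} [CommRing R] (M : Type u) [AddCommGroup M] [Module R M]
    [Nontrivial M] : ∃ p : ℕ∞, projdim R M = p ∧ ∀ d : ℕ, p ≤ d → ∀ n ≥ d, ∀ I J : Ideal R, I ≤ J →
      TorMapZero I J n M := by
  obtain ⟨p, hp⟩ := WithBot.ne_bot_iff_exists.mp (show projdim R M ≠ ⊥ by
    rw [Ne, CategoryTheory.projectiveDimension_eq_bot_iff, ModuleCat.isZero_iff_subsingleton]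
    exact not_subsingleton M)
  refine ⟨p, hp.symm, fun d hd n hn I J hIJ => ?_⟩
  have hd' : projdim R M ≤ (d : ℕ) := by
    rw [← hp]
    exact WithBot.coe_le_coe.mpr hd
  have h := (CategoryTheory.projectiveDimension_le_iff _ d).mp hd'
  exact TorMapZero.of_hasProjectiveDimensionLT hIJ n M
    (CategoryTheory.hasProjectiveDimensionLT_of_ge _ (d + 1) _ (by omega))

theorem ENat.exists_natCast_eq_add_one {a : ℕ∞} {d : ℕ} (h : a + 1 ≤ d) :
    ∃ e : ℕ, d = e + 1 ∧ a ≤ e := by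
  obtain ⟨a, rfl⟩ := ENat.ne_top_iff_exists.mp
    (ne_top_of_le_ne_top (ENat.natCast_ne_top d) (le_self_add.trans h))
  have h' : a + 1 ≤ d := by exact_mod_cast h
  exact ⟨d - 1, by omega, by exact_mod_cast (by omega : a ≤ d - 1)⟩

/-- The inequalities between linearity defects `a`, `b`, `c` and projective dimensions in a short
exact sequence, where the linearity defects are characterized by the vanishing of maps between Tor
modules. -/
theorem linDefect_inequalities {R : Type u} [CommRing R] (m : Ideal R) {M P N : Type u}
    [AddCommGroup M] [Module R M] [AddCommGroup P] [Module R P] [AddCommGroup N] [Module R N]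
    [Nontrivial M] [Nontrivial P] [Nontrivial N] (φ : M →ₗ[R] P) (lam : P →ₗ[R] N)
    (hφ : Function.Injective φ) (hex : Function.Exact φ lam) (hlam : Function.Surjective lam)
    {a b c : ℕ∞}
    (ha : ∀ d : ℕ, a ≤ d ↔ ∀ n ≥ d, ∀ q, TorMapZero (m ^ (q + 1)) (m ^ q) n M)
    (hb : ∀ d : ℕ, b ≤ d ↔ ∀ n ≥ d, ∀ q, TorMapZero (m ^ (q + 1)) (m ^ q) n P)
    (hc : ∀ d : ℕ, c ≤ d ↔ ∀ n ≥ d, ∀ q, TorMapZero (m ^ (q + 1)) (m ^ q) n N) :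
    ((c : WithBot ℕ∞) ≤
      min (max (projdim R P + 1) ((a + 1 : ℕ∞) : WithBot ℕ∞)) (max b (projdim R M + 1))) ∧
    ((b : WithBot ℕ∞) ≤ min (max (projdim R M + 1) c) (max a (projdim R N))) ∧
    ((a : WithBot ℕ∞) ≤
      min (max ((c - 1 : ℕ∞) : WithBot ℕ∞) (projdim R P)) (max (projdim R N) b)) ∧
    (Module.Free R P → (1 ≤ c → a = c - 1) ∧ (¬ 1 ≤ c → a = 0)) ∧
    (projdim R M < ⊤ → (b < ⊤ ↔ c < ⊤)) ∧
    (projdim R P < ⊤ → (a < ⊤ ↔ c < ⊤)) ∧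
    (projdim R N < ⊤ → (a < ⊤ ↔ b < ⊤)) := by
  obtain ⟨p, hp, hpM⟩ := exists_projdim_eq_coe (R := R) M
  obtain ⟨r, hr, hrP⟩ := exists_projdim_eq_coe (R := R) P
  obtain ⟨s, hs, hsN⟩ := exists_projdim_eq_coe (R := R) N
  have hle (q : ℕ) : m ^ (q + 1) ≤ m ^ q := Ideal.pow_le_pow_right q.le_succ
  have c1 : c ≤ max (r + 1) (a + 1) := by
    refine ENat.le_of_forall_le_natCast fun d hd => (hc d).mpr fun n hn q => ?_
    -- The bound `a + 1 ≤ d` makes `d` positive, which leaves room for the index shift of the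
    -- connecting map.
    obtain ⟨e, rfl, he⟩ := ENat.exists_natCast_eq_add_one ((le_max_right _ _).trans hd)
    obtain ⟨n, rfl⟩ : ∃ k, n = k + 1 := ⟨n - 1, by omega⟩
    exact TorMapZero.right (hle q) le_rfl n φ lam hφ hex hlam ((ha e).mp he n (by omega) q)
      (hrP _ ((le_max_left _ _).trans hd |> le_self_add.trans) _ hn _ _ le_rfl)
  have c2 : c ≤ max b (p + 1) := by
    refine ENat.le_of_forall_le_natCast fun d hd => (hc d).mpr fun n hn q => ?_
    obtain ⟨e, rfl, he⟩ := ENat.exists_natCast_eq_add_one ((le_max_right _ _).trans hd)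
    obtain ⟨n, rfl⟩ : ∃ k, n = k + 1 := ⟨n - 1, by omega⟩
    exact TorMapZero.right le_rfl (hle q) n φ lam hφ hex hlam (hpM e he n (by omega) _ _ le_rfl)
      ((hb _).mp ((le_max_left _ _).trans hd) _ hn q)
  have b1 : b ≤ max p c := by
    refine ENat.le_of_forall_le_natCast fun d hd => (hb d).mpr fun n hn q => ?_
    exact TorMapZero.middle (hle q) le_rfl n φ lam hφ hex hlam
      ((hc d).mp ((le_max_right _ _).trans hd) n hn q)
      (hpM d ((le_max_left _ _).trans hd) n hn _ _ le_rfl)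
  have b2 : b ≤ max a s := by
    refine ENat.le_of_forall_le_natCast fun d hd => (hb d).mpr fun n hn q => ?_
    exact TorMapZero.middle le_rfl (hle q) n φ lam hφ hex hlam
      (hsN d ((le_max_right _ _).trans hd) n hn _ _ le_rfl)
      ((ha d).mp ((le_max_left _ _).trans hd) n hn q)
  have a1 : a ≤ max (c - 1) r := by
    refine ENat.le_of_forall_le_natCast fun d hd => (ha d).mpr fun n hn q => ?_
    -- The connecting map starts one degree higher on `N`, whence `c - 1`.
    have hcd : c ≤ (d + 1 : ℕ) := by
      have := (le_max_left _ _).trans hd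
      rw [tsub_le_iff_right] at this
      exact_mod_cast this
    exact TorMapZero.left le_rfl (hle q) n φ lam hφ hex hlam
      (hrP d ((le_max_right _ _).trans hd) n hn _ _ le_rfl) ((hc _).mp hcd _ (by omega) q)
  have a2 : a ≤ max s b := by
    refine ENat.le_of_forall_le_natCast fun d hd => (ha d).mpr fun n hn q => ?_
    exact TorMapZero.left (hle q) le_rfl n φ lam hφ hex hlam
      ((hb d).mp ((le_max_right _ _).trans hd) n hn q)
      (hsN d ((le_max_left _ _).trans hd) _ (by omega) _ _ le_rfl)
  have hfin {x y : ℕ∞} (hx : x < ⊤) (hy : y < ⊤) : max x (y + 1) < ⊤ :=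
    max_lt hx (WithTop.add_lt_top.mpr ⟨hy, ENat.one_lt_top⟩)
  rw [hp, hr, hs]
  refine ⟨le_min ?_ ?_, le_min ?_ ?_, le_min ?_ ?_, fun hP => ?_, fun h => ?_, fun h => ?_,
    fun h => ?_⟩
  · exact_mod_cast c1
  · exact_mod_cast c2
  -- The bound `max p c` is sharper than the one required.
  · exact_mod_cast b1.trans (max_le_max_right c le_self_add)
  · exact_mod_cast b2
  · exact_mod_cast a1
  · exact_mod_cast a2
  · have hr0 : r = 0 := by
      have h1 : projdim R P ≤ (0 : ℕ) := by
        rw [CategoryTheory.projectiveDimension_le_iff,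
          ← CategoryTheory.projective_iff_hasProjectiveDimensionLE_zero,
          ← IsProjective.iff_projective]
        infer_instance
      rw [hr] at h1
      exact le_zero_iff.mp (WithBot.coe_le_coe.mp h1)
    subst hr0
    rw [max_eq_left zero_le] at a1
    rw [max_eq_right (add_le_add_left zero_le 1)] at c1
    exact ⟨fun _ => a1.antisymm (tsub_le_iff_right.mpr c1), fun hc1 => le_zero_iff.mp
      (a1.trans (tsub_le_iff_right.mpr (by simpa using (not_le.mp hc1).le)))⟩
  · have h : p < ⊤ := WithBot.coe_lt_coe.mp h
    exact ⟨fun hb => c2.trans_lt (hfin hb h), fun hc => b1.trans_lt (max_lt h hc)⟩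
  · have h : r < ⊤ := WithBot.coe_lt_coe.mp h
    exact ⟨fun ha => c1.trans_lt (max_lt (WithTop.add_lt_top.mpr ⟨h, ENat.one_lt_top⟩)
      (WithTop.add_lt_top.mpr ⟨ha, ENat.one_lt_top⟩)),
      fun hc => a1.trans_lt (max_lt (tsub_le_self.trans_lt hc) h)⟩
  · have h : s < ⊤ := WithBot.coe_lt_coe.mp h
    exact ⟨fun ha => b2.trans_lt (max_lt ha h), fun hb => a2.trans_lt (max_lt h hb)⟩

/-! ### Existence of minimal free resolutions -/

theorem exists_seq_of_forall_exists {σ : Type*} {r : σ → σ → Prop} (h : ∀ s, ∃ t, r s t) (s : σ) :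
    ∃ t : ℕ → σ, t 0 = s ∧ ∀ i, r (t i) (t (i + 1)) := by
  choose g hg using h
  refine ⟨fun n => g^[n] s, rfl, fun i => ?_⟩
  simp only [Function.iterate_succ_apply']
  exact hg _

/-! ### Smallest generating families -/

section Cover

variable {R : Type u} [CommRing R]

theorem mem_smul_top_of_forall_mem {m : Ideal R} {n : ℕ} {x : Fin n → R} (h : ∀ j, x j ∈ m) :
    x ∈ m • (⊤ : Submodule R (Fin n → R)) := by
  rw [pi_eq_sum_univ' x]
  exact sum_mem fun j _ => Submodule.smul_mem_smul (h j) trivial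

/-- A finite family of generators with property `p` that is as small as possible only has relations
without unit coefficients. -/
theorem exists_family_span_eq_of_finite {X : Type v} [AddCommGroup X] [Module R X]
    (p : X → Prop) {s : Set X} (hs : s.Finite) (hp : ∀ x ∈ s, p x) :
    ∃ (n : ℕ) (g : Fin n → X), (∀ j, p (g j)) ∧
      Submodule.span R (Set.range g) = Submodule.span R s ∧
      ∀ x : Fin n → R, ∑ i, x i • g i = 0 → ∀ j, ¬ IsUnit (x j) := by
  classical
  have hex : ∃ (n : ℕ) (g : Fin n → X), (∀ j, p (g j)) ∧
      Submodule.span R (Set.range g) = Submodule.span R s := by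
    obtain ⟨n, g, -, rfl⟩ := hs.fin_param
    exact ⟨n, g, fun j => hp _ ⟨j, rfl⟩, rfl⟩
  obtain ⟨g, hg, hspan⟩ := Nat.find_spec hex
  refine ⟨Nat.find hex, g, hg, hspan, fun x hx j hj => ?_⟩
  have hmin := fun k hk => Nat.find_min hex (m := k) hk
  generalize Nat.find hex = n at *
  obtain _ | n := n
  · exact j.elim0
  -- A unit coefficient at `j` makes `g j` redundant, contradicting the choice of the length.
  refine hmin n n.lt_succ_self ⟨g ∘ j.succAbove, fun i => hg _, ?_⟩
  rw [← hspan]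
  refine (Submodule.span_mono (Set.range_comp_subset_range _ _)).antisymm
    (Submodule.span_le.mpr ?_)
  have hmem (i) : g (j.succAbove i) ∈ Submodule.span R (Set.range (g ∘ j.succAbove)) :=
    Submodule.subset_span ⟨i, rfl⟩
  rintro _ ⟨i, rfl⟩
  obtain rfl | ⟨i, rfl⟩ := Fin.eq_self_or_eq_succAbove j i
  · rw [Fin.sum_univ_succAbove _ i] at hx
    rw [SetLike.mem_coe, ← Submodule.smul_mem_iff_of_isUnit _ hj, eq_neg_of_add_eq_zero_left hx]
    exact neg_mem (sum_mem fun l _ => Submodule.smul_mem _ _ (hmem l))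
  · exact hmem i

end Cover

/-! ### Noetherian local rings -/

section Local

variable {R : Type u} [CommRing R] [IsLocalRing R]

theorem exists_minimal_cover {X : Type v} [AddCommGroup X] [Module R X] {K : Submodule R X}
    (hK : K.FG) : ∃ (n : ℕ) (f : (Fin n → R) →ₗ[R] X), LinearMap.range f = K ∧
      LinearMap.ker f ≤ IsLocalRing.maximalIdeal R • ⊤ := by
  obtain ⟨s, rfl⟩ := hK
  obtain ⟨n, g, -, hg, h⟩ := exists_family_span_eq_of_finite (R := R) (fun _ => True)
    s.finite_toSet (by simp)
  refine ⟨n, Fintype.linearCombination R g, ?_, fun x hx => mem_smul_top_of_forall_mem fun j => ?_⟩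
  · rw [Fintype.range_linearCombination, hg]
  · exact h x (by rwa [LinearMap.mem_ker, Fintype.linearCombination_apply] at hx) j

variable (R) in
theorem nonempty_minimalFreeResolution [IsNoetherianRing R] (M : Type v) [AddCommGroup M]
    [Module R M] [Module.Finite R M] :
    Nonempty (MinimalFreeResolution (IsLocalRing.maximalIdeal R) M) := by
  -- A state records the current free module and the kernel that the next differential must cover.
  let σ := Σ n : ℕ, {K : Submodule R (Fin n → R) // K ≤ IsLocalRing.maximalIdeal R • ⊤}
  have step (s : σ) : ∃ t : σ, ∃ f : (Fin t.1 → R) →ₗ[R] (Fin s.1 → R),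
      LinearMap.range f = s.2.1 ∧ LinearMap.ker f = t.2.1 := by
    obtain ⟨n, f, h1, h2⟩ := exists_minimal_cover (IsNoetherian.noetherian s.2.1)
    exact ⟨⟨n, LinearMap.ker f, h2⟩, f, h1, rfl⟩
  obtain ⟨n, ε, hε, hker⟩ := exists_minimal_cover (R := R) (Module.Finite.fg_top (R := R) (M := M))
  obtain ⟨t, ht, hstep⟩ := exists_seq_of_forall_exists step ⟨n, LinearMap.ker ε, hker⟩
  choose d hrange hkerd using hstep
  have hn : (t 0).1 = n := congrArg Sigma.fst ht
  obtain ⟨ε, hε, hker⟩ : ∃ ε : (Fin (t 0).1 → R) →ₗ[R] M, LinearMap.range ε = ⊤ ∧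
      LinearMap.ker ε = (t 0).2.1 := by
    rw [ht]
    exact ⟨ε, hε, rfl⟩
  exact ⟨{
    rank := fun i => (t i).1
    d := d
    ε := ε
    ε_surjective := LinearMap.range_eq_top.mp hε
    exact_zero := LinearMap.exact_iff.mpr (by rw [hker, hrange])
    exact_succ := fun i => LinearMap.exact_iff.mpr (by rw [hkerd, hrange])
    minimal := fun i => (hrange i).trans_le (t i).2.2 }⟩

theorem lind_eq_linDefect {M : Type u} [AddCommGroup M] [Module R M]
    (F : MinimalFreeResolution (IsLocalRing.maximalIdeal R) M) : lind R M = F.linDefect :=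
  (iSup_le fun F' => (F'.linDefect_eq F).le).antisymm
    (le_iSup (fun F => MinimalFreeResolution.linDefect F) F)

end Local

/-! ### Standard graded algebras -/

section Graded

variable {k : Type w} [Field k] {A : Type u} [CommRing A] [Algebra k A]

theorem IsStandardGraded.isNoetherianRing {𝒜 : ℕ → Submodule k A} [GradedAlgebra 𝒜]
    (h : IsStandardGraded 𝒜) : IsNoetherianRing A := by
  obtain ⟨s, hs⟩ := Module.Finite.iff_fg.mp h.finite_one
  have : Algebra.FiniteType k A := ⟨⟨s, by rw [← Algebra.adjoin_span, hs, h.adjoin_one]⟩⟩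
  exact Algebra.FiniteType.isNoetherianRing k A

/-- The projection of `A` to its homogeneous component of degree `n`, for an integer `n`. -/
def intProj (𝒜 : ℕ → Submodule k A) [GradedAlgebra 𝒜] : ℤ → A →+ A
  | Int.ofNat n => GradedRing.proj 𝒜 n
  | Int.negSucc _ => 0

/-- The homogeneous component of degree `i` of the graded module `⨁ j, A(- b j)`. -/
def shiftedPiece (𝒜 : ℕ → Submodule k A) {n : ℕ} (b : Fin n → ℤ) (i : ℤ) :
    AddSubgroup (Fin n → A) where
  carrier := {x | ∀ l, x l ∈ intPiece 𝒜 (i - b l)}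
  add_mem' hx hy l := add_mem (hx l) (hy l)
  zero_mem' _ := zero_mem _
  neg_mem' hx l := neg_mem (hx l)

/-- The degree `i` component of an element of `⨁ j, A(- b j)`. -/
def shiftedProj (𝒜 : ℕ → Submodule k A) [GradedAlgebra 𝒜] {n : ℕ} (b : Fin n → ℤ) (i : ℤ)
    (x : Fin n → A) : Fin n → A :=
  fun l => intProj 𝒜 (i - b l) (x l)

/-- A family of homogeneous components of a module over a graded ring, which are independent but
need not span the module. -/
structure IsGradedFamily (𝒜 : ℕ → Submodule k A) {X : Type v} [AddCommGroup X] [Module A X]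
    (𝒳 : ℤ → AddSubgroup X) : Prop where
  eq_zero_of_sum_eq_zero : ∀ (s : Finset ℤ) (y : ℤ → X), (∀ i, y i ∈ 𝒳 i) → ∑ i ∈ s, y i = 0 →
    ∀ i ∈ s, y i = 0
  smul_mem : ∀ (i : ℕ) (j : ℤ) (a : A) (x : X), a ∈ 𝒜 i → x ∈ 𝒳 j → a • x ∈ 𝒳 (i + j)

variable {𝒜 : ℕ → Submodule k A}

theorem IsGradedModule.isGradedFamily {M : Type v} [AddCommGroup M] [Module A M]
    {ℳ : ℤ → AddSubgroup M} (h : IsGradedModule 𝒜 ℳ) : IsGradedFamily 𝒜 ℳ where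
  smul_mem := h.smul_mem
  eq_zero_of_sum_eq_zero s y hy hsum i hi := by
    classical
    have h0 : ∑ j ∈ s, DirectSum.of (fun j => ℳ j) j ⟨y j, hy j⟩ = 0 :=
      h.isInternal.injective (by
        rw [map_sum, map_zero, ← hsum]
        exact Finset.sum_congr rfl fun j _ => DirectSum.coeAddMonoidHom_of ℳ j _)
    have h1 := congrArg (fun z => ((z i : ℳ i) : M)) h0
    rw [DFinsupp.finsetSum_apply, Finset.sum_eq_single_of_mem i hi, DirectSum.of_eq_same] at h1
    · exact h1
    · exact fun j _ hj => DirectSum.of_eq_of_ne _ _ _ hj.symm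

section

variable {X : Type v} [AddCommGroup X] [Module A X] {𝒳 : ℤ → AddSubgroup X}

/-- A submodule that is generated by finitely many homogeneous elements. -/
def IsHomogeneousFG (𝒳 : ℤ → AddSubgroup X) (K : Submodule A X) : Prop :=
  ∃ s : Set X, s.Finite ∧ (∀ x ∈ s, ∃ i, x ∈ 𝒳 i) ∧ Submodule.span A s = K

theorem IsHomogeneousFG.of_fg {K : Submodule A X} (hK : K.FG)
    (h : ∀ x ∈ K, ∃ s : Set X, s.Finite ∧ (∀ y ∈ s, y ∈ K ∧ ∃ i, y ∈ 𝒳 i) ∧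
      x ∈ Submodule.span A s) : IsHomogeneousFG 𝒳 K := by
  obtain ⟨g, rfl⟩ := hK
  choose! s hs hsK hxs using h
  refine ⟨⋃ x ∈ g, s x, g.finite_toSet.biUnion fun x hx => hs x (Submodule.subset_span hx), ?_,
    (Submodule.span_le.mpr ?_).antisymm (Submodule.span_le.mpr ?_)⟩
  · intro y hy
    simp only [Set.mem_iUnion] at hy
    obtain ⟨x, hx, hy⟩ := hy
    exact (hsK x (Submodule.subset_span hx) y hy).2
  · intro y hy
    simp only [Set.mem_iUnion] at hy
    obtain ⟨x, hx, hy⟩ := hy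
    exact (hsK x (Submodule.subset_span hx) y hy).1
  · exact fun x hx => Submodule.span_mono (Set.subset_biUnion_of_mem (u := s) hx)
      (hxs x (Submodule.subset_span hx))

theorem IsGradedFamily.intPiece_smul_mem (h𝒳 : IsGradedFamily 𝒜 𝒳) {i j : ℤ} {a : A} {x : X}
    (ha : a ∈ intPiece 𝒜 i) (hx : x ∈ 𝒳 j) : a • x ∈ 𝒳 (i + j) := by
  cases i with
  | ofNat n => exact h𝒳.smul_mem n j a x ha hx
  | negSucc n =>
    rw [(Submodule.mem_bot k).mp ha, zero_smul]
    exact zero_mem _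

end

theorem IsGradedModule.isHomogeneousFG_top {M : Type v} [AddCommGroup M] [Module A M]
    [Module.Finite A M] {ℳ : ℤ → AddSubgroup M} (h : IsGradedModule 𝒜 ℳ) :
    IsHomogeneousFG ℳ (⊤ : Submodule A M) := by
  classical
  refine .of_fg Module.Finite.fg_top fun x _ => ?_
  obtain ⟨y, rfl⟩ := h.isInternal.surjective x
  refine ⟨(fun i => (y i : M)) '' y.support, y.support.finite_toSet.image _, ?_, ?_⟩
  · rintro _ ⟨i, -, rfl⟩
    exact ⟨trivial, i, (y i).2⟩
  · rw [DirectSum.coeAddMonoidHom_eq_dfinsuppSum]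
    exact sum_mem fun i hi => Submodule.subset_span ⟨i, hi, rfl⟩

variable (𝒜) [GradedAlgebra 𝒜]

theorem intProj_mem (i : ℤ) (a : A) : intProj 𝒜 i a ∈ intPiece 𝒜 i := by
  cases i with
  | ofNat n => exact SetLike.coe_mem (DirectSum.decompose 𝒜 a n)
  | negSucc n => exact zero_mem _

theorem intProj_of_mem {i : ℤ} {a : A} (ha : a ∈ intPiece 𝒜 i) : intProj 𝒜 i a = a := by
  cases i with
  | ofNat n => exact DirectSum.decompose_of_mem_same 𝒜 ha
  | negSucc n => exact ((Submodule.mem_bot k).mp ha).symm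

theorem intProj_of_mem_ne {i j : ℤ} {a : A} (ha : a ∈ intPiece 𝒜 i) (hij : i ≠ j) :
    intProj 𝒜 j a = 0 := by
  cases j with
  | negSucc n => rfl
  | ofNat n =>
    cases i with
    | ofNat l => exact DirectSum.decompose_of_mem_ne 𝒜 ha fun h => hij (congrArg _ h)
    | negSucc l => rw [(Submodule.mem_bot k).mp ha, map_zero]

/-- Permitting every larger index set lets finitely many coordinates share one. -/
theorem exists_sum_intProj (a : A) :
    ∃ s : Finset ℤ, ∀ t, s ⊆ t → ∑ i ∈ t, intProj 𝒜 i a = a := by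
  classical
  refine ⟨(DirectSum.decompose 𝒜 a).support.map ⟨Int.ofNat, fun _ _ => Int.ofNat.inj⟩,
    fun t ht => ?_⟩
  rw [← Finset.sum_subset ht, Finset.sum_map]
  · exact DirectSum.sum_support_decompose 𝒜 a
  · intro i _ hi
    cases i with
    | negSucc n => rfl
    | ofNat n =>
      by_contra h
      refine hi (Finset.mem_map.mpr ⟨n, DFinsupp.mem_support_iff.mpr fun h0 => h ?_, rfl⟩)
      exact congrArg Subtype.val h0

theorem exists_sum_shiftedProj {n : ℕ} (b : Fin n → ℤ) (x : Fin n → A) :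
    ∃ s : Finset ℤ, ∀ t, s ⊆ t → ∑ i ∈ t, shiftedProj 𝒜 b i x = x := by
  classical
  choose s hs using fun l => exists_sum_intProj 𝒜 (x l)
  refine ⟨Finset.univ.biUnion fun l => (s l).image (· + b l), fun t ht => ?_⟩
  ext l
  rw [Finset.sum_apply]
  have := hs l (t.map (Equiv.subRight (b l)).toEmbedding) fun i hi => by
    rw [Finset.mem_map_equiv]
    exact ht (Finset.mem_biUnion.mpr ⟨l, Finset.mem_univ _, Finset.mem_image_of_mem _ hi⟩)
  rwa [Finset.sum_map] at this

theorem shiftedProj_mem {n : ℕ} (b : Fin n → ℤ) (i : ℤ) (x : Fin n → A) :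
    shiftedProj 𝒜 b i x ∈ shiftedPiece 𝒜 b i :=
  fun _ => intProj_mem 𝒜 _ _

theorem isGradedFamily_shiftedPiece {n : ℕ} (b : Fin n → ℤ) :
    IsGradedFamily 𝒜 (shiftedPiece 𝒜 b) where
  eq_zero_of_sum_eq_zero s y hy h i hi := by
    ext l
    have h1 := congrArg (intProj 𝒜 (i - b l)) (congrFun h l)
    rw [Finset.sum_apply, map_sum, Finset.sum_eq_single_of_mem i hi, intProj_of_mem 𝒜 (hy i l)]
      at h1
    · rw [h1, Pi.zero_apply, map_zero]
    · exact fun j _ hj => intProj_of_mem_ne 𝒜 (hy j l) (by omega)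
  smul_mem i j a x ha hx l := by
    have hxl := hx l
    rw [show (i : ℤ) + j - b l = i + (j - b l) by omega, Pi.smul_apply, smul_eq_mul]
    generalize j - b l = z at *
    cases z with
    | ofNat n => exact SetLike.mul_mem_graded (A := 𝒜) ha hxl
    | negSucc n =>
      rw [(Submodule.mem_bot k).mp hxl, mul_zero]
      exact zero_mem _

variable {𝒜}

section

variable {X : Type v} [AddCommGroup X] [Module A X] {𝒳 : ℤ → AddSubgroup X}

/-- The images of the components of `x` are homogeneous of distinct degrees and add up to zero, so
each is zero. -/
theorem IsGradedFamily.shiftedProj_mem_ker (h𝒳 : IsGradedFamily 𝒜 𝒳) {n : ℕ} {g : Fin n → X}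
    {b : Fin n → ℤ} (hg : ∀ j, g j ∈ 𝒳 (b j)) {x : Fin n → A}
    (hx : x ∈ LinearMap.ker (Fintype.linearCombination A g)) (i : ℤ) :
    shiftedProj 𝒜 b i x ∈ LinearMap.ker (Fintype.linearCombination A g) := by
  classical
  obtain ⟨s, hs⟩ := exists_sum_shiftedProj 𝒜 b x
  refine h𝒳.eq_zero_of_sum_eq_zero (insert i s)
    (fun i => Fintype.linearCombination A g (shiftedProj 𝒜 b i x)) (fun i => ?_) ?_ i
    (Finset.mem_insert_self i s)
  · rw [Fintype.linearCombination_apply]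
    refine sum_mem fun j _ => ?_
    have := h𝒳.intPiece_smul_mem (shiftedProj_mem 𝒜 b i x j) (hg j)
    rwa [sub_add_cancel] at this
  · rw [← map_sum, hs _ (Finset.subset_insert i s)]
    exact hx

theorem IsGradedFamily.exists_minimal_cover (h𝒜 : IsStandardGraded 𝒜)
    (h𝒳 : IsGradedFamily 𝒜 𝒳) {K : Submodule A X} (hK : IsHomogeneousFG 𝒳 K) :
    ∃ (n : ℕ) (b : Fin n → ℤ) (f : (Fin n → A) →ₗ[A] X), LinearMap.range f = K ∧
      (∀ j, f (Pi.single j 1) ∈ 𝒳 (b j)) ∧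
      LinearMap.ker f ≤ (HomogeneousIdeal.irrelevant 𝒜).toIdeal • ⊤ ∧
      IsHomogeneousFG (shiftedPiece 𝒜 b) (LinearMap.ker f) := by
  classical
  obtain ⟨s, hs, hhom, rfl⟩ := hK
  obtain ⟨n, g, hg, hspan, h⟩ := exists_family_span_eq_of_finite (R := A) _ hs hhom
  choose b hb using hg
  refine ⟨n, b, Fintype.linearCombination A g, ?_, fun j => ?_,
    fun x hx => mem_smul_top_of_forall_mem fun j => ?_, .of_fg ?_ fun x hx => ?_⟩
  · rw [Fintype.range_linearCombination, hspan]
  · rw [Fintype.linearCombination_apply_single, one_smul]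
    exact hb j
  -- The component of degree `b j` of a relation is again a relation, and its `j`-th coefficient is
  -- the degree-zero part of `x j`. This is a scalar and not a unit, hence zero.
  · have hz : shiftedProj 𝒜 b (b j) x j = GradedRing.proj 𝒜 0 (x j) := by
      rw [shiftedProj, sub_self]
      rfl
    have hx' := h𝒳.shiftedProj_mem_ker hb hx (b j)
    rw [LinearMap.mem_ker, Fintype.linearCombination_apply] at hx'
    have hu := h _ hx' j
    rw [hz] at hu
    rw [HomogeneousIdeal.mem_iff, HomogeneousIdeal.mem_irrelevant_iff]
    obtain ⟨c, hc⟩ : GradedRing.proj 𝒜 0 (x j) ∈ LinearMap.range (Algebra.linearMap k A) := by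
      rw [← h𝒜.zero_eq]
      exact SetLike.coe_mem (DirectSum.decompose 𝒜 (x j) 0)
    rw [← hc] at hu ⊢
    by_contra hc0
    have : c ≠ 0 := by
      rintro rfl
      exact hc0 (map_zero _)
    exact hu ((IsUnit.mk0 c this).map (algebraMap k A))
  · have := h𝒜.isNoetherianRing
    exact IsNoetherian.noetherian _
  · obtain ⟨t, ht⟩ := exists_sum_shiftedProj 𝒜 b x
    refine ⟨(fun i => shiftedProj 𝒜 b i x) '' t, t.finite_toSet.image _, ?_, ?_⟩
    · rintro _ ⟨i, -, rfl⟩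
      exact ⟨h𝒳.shiftedProj_mem_ker hb hx i, i, shiftedProj_mem 𝒜 b i x⟩
    · have : ∑ i ∈ t, shiftedProj 𝒜 b i x ∈
          Submodule.span A ((fun i => shiftedProj 𝒜 b i x) '' (t : Set ℤ)) :=
        sum_mem fun i hi => Submodule.subset_span ⟨i, hi, rfl⟩
      rwa [ht t subset_rfl] at this

end

theorem IsGradedModule.exists_minimalFreeResolution (h𝒜 : IsStandardGraded 𝒜) {M : Type v}
    [AddCommGroup M] [Module A M] [Module.Finite A M] {ℳ : ℤ → AddSubgroup M}
    (h : IsGradedModule 𝒜 ℳ) :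
    ∃ F : MinimalFreeResolution (HomogeneousIdeal.irrelevant 𝒜).toIdeal M, F.IsGraded 𝒜 ℳ := by
  let σ := Σ n : ℕ, Σ b : Fin n → ℤ, {K : Submodule A (Fin n → A) //
    K ≤ (HomogeneousIdeal.irrelevant 𝒜).toIdeal • ⊤ ∧ IsHomogeneousFG (shiftedPiece 𝒜 b) K}
  have step (s : σ) : ∃ t : σ, ∃ f : (Fin t.1 → A) →ₗ[A] (Fin s.1 → A),
      LinearMap.range f = s.2.2.1 ∧ LinearMap.ker f = t.2.2.1 ∧
      ∀ j, f (Pi.single j 1) ∈ shiftedPiece 𝒜 s.2.1 (t.2.1 j) := by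
    obtain ⟨n, b, f, h1, h2, h3, h4⟩ :=
      (isGradedFamily_shiftedPiece 𝒜 s.2.1).exists_minimal_cover h𝒜 s.2.2.2.2
    exact ⟨⟨n, b, LinearMap.ker f, h3, h4⟩, f, h1, rfl, h2⟩
  obtain ⟨n, b, ε, h1, h2, h3, h4⟩ :=
    h.isGradedFamily.exists_minimal_cover h𝒜 h.isHomogeneousFG_top
  obtain ⟨t, ht, hstep⟩ := exists_seq_of_forall_exists step ⟨n, b, LinearMap.ker ε, h3, h4⟩
  choose d hrange hkerd hdeg using hstep
  obtain ⟨ε, hε, hker, hε'⟩ : ∃ ε : (Fin (t 0).1 → A) →ₗ[A] M, LinearMap.range ε = ⊤ ∧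
      LinearMap.ker ε = (t 0).2.2.1 ∧ ∀ j, ε (Pi.single j 1) ∈ ℳ ((t 0).2.1 j) := by
    rw [ht]
    exact ⟨ε, h1, rfl, h2⟩
  exact ⟨{
    rank := fun i => (t i).1
    d := d
    ε := ε
    ε_surjective := LinearMap.range_eq_top.mp hε
    exact_zero := LinearMap.exact_iff.mpr (by rw [hker, hrange])
    exact_succ := fun i => LinearMap.exact_iff.mpr (by rw [hkerd, hrange])
    minimal := fun i => (hrange i).trans_le (t i).2.2.2.1 }, fun i => (t i).2.1, hε',
    fun i j => hdeg i j⟩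

theorem gradedLind_eq_linDefect {M : Type u} [AddCommGroup M] [Module A M]
    {ℳ : ℤ → AddSubgroup M}
    (F : MinimalFreeResolution (HomogeneousIdeal.irrelevant 𝒜).toIdeal M) (hF : F.IsGraded 𝒜 ℳ) :
    gradedLind 𝒜 ℳ = F.linDefect :=
  (iSup_le fun F' => (F'.1.linDefect_eq F).le).antisymm
    (le_iSup (fun F : {F : MinimalFreeResolution (HomogeneousIdeal.irrelevant 𝒜).toIdeal M //
      F.IsGraded 𝒜 ℳ} => F.1.linDefect) ⟨F, hF⟩)

end Graded

/-- The linearity defects and projective dimensions in a short exact sequence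
`0 → M → P → N → 0` of nonzero finitely generated modules, over a noetherian local ring (first
part) and, for graded modules, over a standard graded algebra (second part). The inequalities are
in `WithBot ℕ∞`. The truncated difference `lind N - 1` is compared with nonnegative numbers only,
and `⊤ - 1 = ⊤`. -/
theorem corollary2p8 :
    (∀ (R : Type u) [CommRing R] [IsLocalRing R] [IsNoetherianRing R] (M P N : Type u)
      [AddCommGroup M] [Module R M] [AddCommGroup P] [Module R P] [AddCommGroup N] [Module R N]
      [Module.Finite R M] [Module.Finite R P] [Module.Finite R N]
      [Nontrivial M] [Nontrivial P] [Nontrivial N]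
      (φ : M →ₗ[R] P) (lam : P →ₗ[R] N),
      Function.Injective φ → Function.Exact φ lam → Function.Surjective lam →
      ((lind R N : WithBot ℕ∞) ≤
        min (max (projdim R P + 1) ((lind R M + 1 : ℕ∞) : WithBot ℕ∞))
          (max (lind R P) (projdim R M + 1))) ∧
      ((lind R P : WithBot ℕ∞) ≤
        min (max (projdim R M + 1) (lind R N)) (max (lind R M) (projdim R N))) ∧
      ((lind R M : WithBot ℕ∞) ≤
        min (max ((lind R N - 1 : ℕ∞) : WithBot ℕ∞) (projdim R P)) (max (projdim R N) (lind R P))) ∧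
      (Module.Free R P →
        (1 ≤ lind R N → lind R M = lind R N - 1) ∧ (¬ 1 ≤ lind R N → lind R M = 0)) ∧
      (projdim R M < ⊤ → (lind R P < ⊤ ↔ lind R N < ⊤)) ∧
      (projdim R P < ⊤ → (lind R M < ⊤ ↔ lind R N < ⊤)) ∧
      (projdim R N < ⊤ → (lind R M < ⊤ ↔ lind R P < ⊤))) ∧
    (∀ (k : Type w) [Field k] (A : Type u) [CommRing A] [Algebra k A]
      (𝒜 : ℕ → Submodule k A) [GradedAlgebra 𝒜] (M P N : Type u)
      [AddCommGroup M] [Module A M] [AddCommGroup P] [Module A P] [AddCommGroup N] [Module A N]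
      [Module.Finite A M] [Module.Finite A P] [Module.Finite A N]
      [Nontrivial M] [Nontrivial P] [Nontrivial N]
      (ℳ : ℤ → AddSubgroup M) (𝒬 : ℤ → AddSubgroup P) (𝒩 : ℤ → AddSubgroup N)
      (φ : M →ₗ[A] P) (lam : P →ₗ[A] N),
      IsStandardGraded 𝒜 → IsGradedModule 𝒜 ℳ → IsGradedModule 𝒜 𝒬 → IsGradedModule 𝒜 𝒩 →
      (∀ i, ∀ x ∈ ℳ i, φ x ∈ 𝒬 i) → (∀ i, ∀ x ∈ 𝒬 i, lam x ∈ 𝒩 i) →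
      Function.Injective φ → Function.Exact φ lam → Function.Surjective lam →
      ((gradedLind 𝒜 𝒩 : WithBot ℕ∞) ≤
        min (max (projdim A P + 1) ((gradedLind 𝒜 ℳ + 1 : ℕ∞) : WithBot ℕ∞))
          (max (gradedLind 𝒜 𝒬) (projdim A M + 1))) ∧
      ((gradedLind 𝒜 𝒬 : WithBot ℕ∞) ≤
        min (max (projdim A M + 1) (gradedLind 𝒜 𝒩)) (max (gradedLind 𝒜 ℳ) (projdim A N))) ∧
      ((gradedLind 𝒜 ℳ : WithBot ℕ∞) ≤
        min (max ((gradedLind 𝒜 𝒩 - 1 : ℕ∞) : WithBot ℕ∞) (projdim A P))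
          (max (projdim A N) (gradedLind 𝒜 𝒬))) ∧
      (Module.Free A P →
        (1 ≤ gradedLind 𝒜 𝒩 → gradedLind 𝒜 ℳ = gradedLind 𝒜 𝒩 - 1) ∧
        (¬ 1 ≤ gradedLind 𝒜 𝒩 → gradedLind 𝒜 ℳ = 0)) ∧
      (projdim A M < ⊤ → (gradedLind 𝒜 𝒬 < ⊤ ↔ gradedLind 𝒜 𝒩 < ⊤)) ∧
      (projdim A P < ⊤ → (gradedLind 𝒜 ℳ < ⊤ ↔ gradedLind 𝒜 𝒩 < ⊤)) ∧
      (projdim A N < ⊤ → (gradedLind 𝒜 ℳ < ⊤ ↔ gradedLind 𝒜 𝒬 < ⊤))) := by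
  constructor
  · intro R _ _ _ M P N _ _ _ _ _ _ _ _ _ _ _ _ φ lam hφ hex hlam
    obtain ⟨FM⟩ := nonempty_minimalFreeResolution R M
    obtain ⟨FP⟩ := nonempty_minimalFreeResolution R P
    obtain ⟨FN⟩ := nonempty_minimalFreeResolution R N
    rw [lind_eq_linDefect FM, lind_eq_linDefect FP, lind_eq_linDefect FN]
    exact linDefect_inequalities _ φ lam hφ hex hlam FM.linDefect_le_iff FP.linDefect_le_iff
      FN.linDefect_le_iff
  · intro k _ A _ _ 𝒜 _ M P N _ _ _ _ _ _ _ _ _ _ _ _ ℳ 𝒬 𝒩 φ lam h𝒜 hℳ h𝒬 h𝒩 _ _ hφ hex hlam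
    obtain ⟨FM, hFM⟩ := hℳ.exists_minimalFreeResolution h𝒜
    obtain ⟨FP, hFP⟩ := h𝒬.exists_minimalFreeResolution h𝒜
    obtain ⟨FN, hFN⟩ := h𝒩.exists_minimalFreeResolution h𝒜
    rw [gradedLind_eq_linDefect FM hFM, gradedLind_eq_linDefect FP hFP,
      gradedLind_eq_linDefect FN hFN]
    exact linDefect_inequalities _ φ lam hφ hex hlam FM.linDefect_le_iff FP.linDefect_le_iff
      FN.linDefect_le_iff
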